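/- Let $W$ be a finite, irreducible real reflection group of rank $n\ge 1$ acting on $\mathbf R^n$, with reflection set $\mathcal R$, and for $w\in W$ let $l(w)$ be the least integer $k\ge 0$ such that $w$ is a product of $k$ elements of $\mathcal R$. For a unit vector $v$ let $R(v)$ be the reflection $R(v)(x)=x-2(v\cdot x)v$. Fix a chamber $C$ of $W$ with inward unit normals $\alpha_1,\dots,\alpha_n$, ordered so that, for some $s$, both $\{\alpha_1,\dots,\alpha_s\}$ and $\{\alpha_{s+1},\dots,\alpha_n\}$ are orthonormal sets. Put $R_i=R(\alpha_i)$, let $\gamma=R_1R_2\cdots R_n$, let $h$ be the order of $\gamma$, and let $\rho_i=R_1R_2\cdots R_{i-1}\alpha_i$ for $i\ge 1$, where the $\alpha$'s and the $R$'s are indexed cyclically modulo $n$. (The positive roots relative to $C$ are $\rho_1,\dots,\rho_{nh/2}$.) Then $\gamma-I$ is invertible. Suppose that $\sigma_1=\rho_{m_1},\dots,\sigma_k=\rho_{m_k}$ with $1\le m_1<m_2<\dots<m_k\le nh/2$, and for each $i$ let $\mu(\sigma_i)=-2(\gamma-I)^{-1}\sigma_i$. Then the following are equivalent: (a) $l(R(\sigma_1)R(\sigma_2)\cdots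 R(\sigma_k)\gamma)=n-k$; (b) $\mu(\sigma_i)\cdot\sigma_j=0$ whenever $i>j$. -/

import Mathlib

/-- `ℝⁿ` with its standard inner product. -/
abbrev RSpace (n : ℕ) : Type := EuclideanSpace ℝ (Fin n)

/-- The orthogonal group of `ℝⁿ`; multiplication is composition, `(A * B) x = A (B x)`. -/
abbrev OrthGroup (n : ℕ) : Type := RSpace n ≃ₗᵢ[ℝ] RSpace n

namespace ReflGroup

variable {n : ℕ}

/-- `R(v)`, the orthogonal reflection with fixed subspace `v^⊥` (for `v ≠ 0`). -/
noncomputable def R (v : RSpace n) : OrthGroup n :=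
  (Submodule.span ℝ {v})ᗮ.reflection

/-- For a unit vector `v` the reflection is given by the usual formula. -/
theorem R_apply (v : RSpace n) (hv : ‖v‖ = 1) (x : RSpace n) :
    R v x = x - (2 * inner ℝ v x) • v := by
  rw [R, Submodule.reflection_orthogonal_apply, Submodule.reflection_singleton_apply, hv]
  simp only [one_pow, RCLike.ofReal_one, div_one]
  rw [two_smul, two_mul, add_smul]
  abel

/-- The reflections belonging to `W`. -/
def reflections (W : Subgroup (OrthGroup n)) : Set (OrthGroup n) :=
  {r | r ∈ W ∧ ∃ v : RSpace n, v ≠ 0 ∧ r = R v}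

/-- `W` is a finite, irreducible real reflection group of rank `n`, acting on `ℝⁿ`. -/
structure IsFiniteIrreducibleReflectionGroup (W : Subgroup (OrthGroup n)) : Prop where
  finite : Finite W
  generated : Subgroup.closure (reflections W) = W
  /-- The rank of `W` is `n`: no nonzero vector is fixed by `W`. -/
  essential : ∀ x : RSpace n, (∀ w ∈ W, w x = x) → x = 0
  nontrivial : Nontrivial (RSpace n)
  /-- There is no proper nonzero invariant subspace. -/
  irreducible : ∀ U : Submodule ℝ (RSpace n),
    (∀ w ∈ W, ∀ x ∈ U, w x ∈ U) → U = ⊥ ∨ U = ⊤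

/-- The reflection length on `W`: the least number of reflections of `W` with product `w`.
The empty product is allowed, so that the identity has length `0`. -/
noncomputable def reflLength (W : Subgroup (OrthGroup n)) (w : OrthGroup n) : ℕ :=
  sInf {k | ∃ L : List (OrthGroup n), L.length = k ∧ (∀ r ∈ L, r ∈ reflections W) ∧ L.prod = w}

/-- The complement in `ℝⁿ` of the union of the reflecting hyperplanes of `W`. -/
def regularPoints (W : Subgroup (OrthGroup n)) : Set (RSpace n) :=
  {x | ∀ r ∈ reflections W, r x ≠ x}

/-- A chamber: a connected component of the complement of the reflecting hyperplanes. -/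
def IsChamber (W : Subgroup (OrthGroup n)) (C : Set (RSpace n)) : Prop :=
  ∃ x ∈ regularPoints W, C = connectedComponentIn (regularPoints W) x

/-- `α_1, …, α_n` are the inward unit normals of the chamber `C`: they are unit vectors orthogonal
to reflecting hyperplanes of `W`, and `C` is the intersection of the `n` open half-spaces on
their positive sides. (As `W` has rank `n`, none of these `n` half-spaces is redundant.) -/
structure IsInwardUnitNormals (W : Subgroup (OrthGroup n)) (C : Set (RSpace n))
    (α : Fin n → RSpace n) : Prop where
  unit : ∀ i, ‖α i‖ = 1
  reflecting : ∀ i, R (α i) ∈ W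
  chamber_eq : C = {x | ∀ i, 0 < inner ℝ (α i) x}

/-- The first `s` vectors form an orthonormal set, and so do the remaining ones. -/
def IsBipartiteOrdering (α : Fin n → RSpace n) (s : ℕ) : Prop :=
  Orthonormal ℝ (fun i : {i : Fin n // (i : ℕ) < s} => α i) ∧
    Orthonormal ℝ (fun i : {i : Fin n // s ≤ (i : ℕ)} => α i)

/-- The Coxeter element `γ = R_1 R_2 ⋯ R_n`, where `R_i = R(α_i)`. -/
noncomputable def coxeterElement (α : Fin n → RSpace n) : OrthGroup n :=
  (List.ofFn fun i => R (α i)).prod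

/-- The vectors `α` indexed cyclically modulo `n` (starting from `0`). -/
def cyclic [NeZero n] (α : Fin n → RSpace n) (i : ℕ) : RSpace n :=
  α (Fin.ofNat n i)

/-- `rho α i` is the vector `ρ_{i+1} = R_1 R_2 ⋯ R_i α_{i+1}`, indices being cyclic modulo `n`;
so `ρ_1, ρ_2, …` are `rho α 0, rho α 1, …`. -/
noncomputable def rho [NeZero n] (α : Fin n → RSpace n) (i : ℕ) : RSpace n :=
  ((List.range i).map fun j => R (cyclic α j)).prod (cyclic α i)

/-- `σ_1, …, σ_k` is a subset of `{ρ_1, …, ρ_{nh/2}}`, where `h` is the order of `γ`, listed in the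
order of increasing index in the sequence of the `ρ`'s. -/
def IsConsistentlyOrdered [NeZero n] (α : Fin n → RSpace n) {k : ℕ}
    (σ : Fin k → RSpace n) : Prop :=
  ∃ m : Fin k → ℕ, StrictMono m ∧
    ∀ i, m i < n * orderOf (coxeterElement α) / 2 ∧ σ i = rho α (m i)

/-- The linear map `γ - I` on `ℝⁿ`. -/
noncomputable def subId (γ : OrthGroup n) : Module.End ℝ (RSpace n) :=
  (γ.toLinearEquiv : RSpace n →ₗ[ℝ] RSpace n) - 1

/-- `μ(σ) = -2 (γ - I)⁻¹ σ`. -/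
noncomputable def mu (γ : OrthGroup n) (σ : RSpace n) : RSpace n :=
  (-2 : ℝ) • (Ring.inverse (subId γ)) σ

end ReflGroup

namespace ReflGroup

variable {n : ℕ}

/-! By Carter's formula, reflection length plus the dimension of the fixed space is `n`, so (a) says
that the fixed space of `R(σ_1)⋯R(σ_k)γ` has dimension `k`. The formula needs every nontrivial
element of `W` to have a root orthogonal to its fixed space. This follows from the free action of
`W` on regular points, itself a consequence of the exchange property (`exchange`).

A vector `x` fixed by the product has `(γ - I)x` in the span of the `σ_i`, hence lies in the span of
the `μ(σ_i)`; so `k` is the maximal dimension, and when it is attained the fixed space is that span.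
Prepending one reflection at a time, `finrank_fixedSpace_eq_length_iff` shows that the maximum
persists exactly when the new `σ` is orthogonal to all later `μ`'s. The converse half uses that the
symmetric part of `μ(a)·b` is `a·b` (`inner_mu_add_inner_mu`). -/

theorem R_smul {c : ℝ} (hc : c ≠ 0) (v : RSpace n) : R (c • v) = R v := by
  simp only [R, Submodule.span_singleton_smul_eq (IsUnit.mk0 c hc)]

theorem R_neg (v : RSpace n) : R (-v) = R v := by
  simpa using R_smul (n := n) (c := -1) (by norm_num) v

theorem R_mul_self (v : RSpace n) : R v * R v = 1 :=
  Submodule.reflection_mul_reflection _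

theorem R_inv (v : RSpace n) : (R v)⁻¹ = R v :=
  inv_eq_of_mul_eq_one_left (R_mul_self v)

theorem R_self {v : RSpace n} (hv : ‖v‖ = 1) : R v v = -v := by
  rw [R_apply v hv, real_inner_self_eq_norm_sq, hv, one_pow, mul_one, two_smul]
  abel

theorem R_conj (g : OrthGroup n) {v : RSpace n} (hv : ‖v‖ = 1) :
    R (g v) = g * R v * g⁻¹ := by
  have hg : ‖g v‖ = 1 := by rw [g.norm_map, hv]
  rw [eq_mul_inv_iff_mul_eq]
  ext1 x
  change R (g v) (g x) = g (R v x)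
  rw [R_apply _ hg, R_apply _ hv, g.inner_map_map, map_sub, map_smul]

theorem R_apply_eq_self_iff {v : RSpace n} (hv : ‖v‖ = 1) (x : RSpace n) :
    R v x = x ↔ inner ℝ v x = 0 := by
  have hv0 : v ≠ 0 := by
    rintro rfl
    simp at hv
  rw [R_apply v hv, sub_eq_self, smul_eq_zero]
  simp [hv0]

/-- A unit vector whose reflection belongs to `W`. -/
def IsRoot (W : Subgroup (OrthGroup n)) (β : RSpace n) : Prop :=
  ‖β‖ = 1 ∧ R β ∈ W

theorem IsRoot.ne_zero {W : Subgroup (OrthGroup n)} {β : RSpace n} (h : IsRoot W β) : β ≠ 0 := by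
  rintro rfl
  simpa using h.1

theorem IsRoot.map {W : Subgroup (OrthGroup n)} {β : RSpace n} (h : IsRoot W β)
    {g : OrthGroup n} (hg : g ∈ W) : IsRoot W (g β) := by
  refine ⟨by rw [g.norm_map, h.1], ?_⟩
  rw [R_conj g h.1]
  exact W.mul_mem (W.mul_mem hg h.2) (W.inv_mem hg)

theorem IsRoot.neg {W : Subgroup (OrthGroup n)} {β : RSpace n} (h : IsRoot W β) :
    IsRoot W (-β) :=
  ⟨by rw [norm_neg, h.1], by rw [R_neg]; exact h.2⟩

theorem IsRoot.mem_reflections {W : Subgroup (OrthGroup n)} {β : RSpace n} (h : IsRoot W β) :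
    R β ∈ reflections W :=
  ⟨h.2, β, h.ne_zero, rfl⟩

theorem exists_isRoot_of_mem_reflections {W : Subgroup (OrthGroup n)} {r : OrthGroup n}
    (hr : r ∈ reflections W) : ∃ β, IsRoot W β ∧ r = R β := by
  obtain ⟨hrW, v, hv, rfl⟩ := hr
  have h : R ((‖v‖)⁻¹ • v) = R v := R_smul (inv_ne_zero (norm_ne_zero_iff.2 hv)) v
  refine ⟨(‖v‖)⁻¹ • v, ⟨?_, by rwa [h]⟩, h.symm⟩
  rw [norm_smul, norm_inv, norm_norm, inv_mul_cancel₀ (norm_ne_zero_iff.2 hv)]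

theorem mem_regularPoints_iff {W : Subgroup (OrthGroup n)} {x : RSpace n} :
    x ∈ regularPoints W ↔ ∀ β, IsRoot W β → inner ℝ β x ≠ 0 := by
  constructor
  · intro h β hβ h0
    exact h _ hβ.mem_reflections ((R_apply_eq_self_iff hβ.1 x).2 h0)
  · intro h r hr hx
    obtain ⟨β, hβ, rfl⟩ := exists_isRoot_of_mem_reflections hr
    exact h β hβ ((R_apply_eq_self_iff hβ.1 x).1 hx)

/-! ### Fixed spaces -/

/-- The subspace of vectors fixed by `w`. -/
noncomputable def fixedSpace (w : OrthGroup n) : Submodule ℝ (RSpace n) :=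
  LinearMap.ker (subId w)

theorem subId_apply (w : OrthGroup n) (x : RSpace n) : subId w x = w x - x := rfl

theorem mem_fixedSpace {w : OrthGroup n} {x : RSpace n} : x ∈ fixedSpace w ↔ w x = x := by
  rw [fixedSpace, LinearMap.mem_ker, subId_apply, sub_eq_zero]

/-- Since `w` is an isometry, `x·(wy - y) = wx·wy - x·y = 0` for fixed `x`; rank-nullity turns the
inclusion into equality. -/
theorem range_subId (w : OrthGroup n) : LinearMap.range (subId w) = (fixedSpace w)ᗮ := by
  apply Submodule.eq_of_le_of_finrank_eq
  · rintro _ ⟨y, rfl⟩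
    rw [Submodule.mem_orthogonal]
    intro x hx
    rw [mem_fixedSpace] at hx
    rw [subId_apply, inner_sub_right, ← w.inner_map_map x y, hx, sub_self]
  · have h1 := LinearMap.finrank_range_add_finrank_ker (subId w)
    have h2 := (fixedSpace w).finrank_add_finrank_orthogonal
    rw [fixedSpace] at h2 ⊢
    omega

/-- Multiplying `w` by a reflection in a root orthogonal to its fixed vectors enlarges the fixed
space. -/
theorem fixedSpace_lt_of_mem_orthogonal {w : OrthGroup n} {r : RSpace n} (hr : ‖r‖ = 1)
    (h : r ∈ (fixedSpace w)ᗮ) : fixedSpace w < fixedSpace (R r * w) := by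
  have h' := h
  rw [← range_subId] at h'
  obtain ⟨y, hy⟩ := h'
  rw [subId_apply] at hy
  have hle : fixedSpace w ≤ fixedSpace (R r * w) := by
    intro x hx
    have h0 : inner ℝ r x = 0 := (Submodule.mem_orthogonal' _ _).1 h x hx
    rw [mem_fixedSpace] at hx ⊢
    change R r (w x) = x
    rw [hx, R_apply_eq_self_iff hr, h0]
  refine lt_of_le_of_ne hle fun heq => ?_
  -- With `r = wy - y` and `‖wy‖ = ‖y‖`, reflecting `wy` in `r` gives `y`, so `y` is a newly fixed
  -- vector.
  have hyw : y = w y - r := by rw [← hy]; abel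
  have hin : inner ℝ r (w y) = 1 / 2 := by
    have h1 : ‖w y - r‖ ^ 2 = ‖w y‖ ^ 2 := by rw [← hyw, w.norm_map]
    rw [norm_sub_sq_real, hr, real_inner_comm] at h1
    linarith
  have hyf : y ∈ fixedSpace (R r * w) := by
    rw [mem_fixedSpace]
    change R r (w y) = y
    rw [R_apply r hr, hin]
    norm_num
    exact hyw.symm
  rw [← heq, mem_fixedSpace] at hyf
  rw [hyf, sub_self] at hy
  rw [← hy, norm_zero] at hr
  exact zero_ne_one hr

/-! ### Simple systems, exchange and the free action -/

/-- The `α i` are the simple roots for the chamber of `W` containing `x₀`: every root that is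
nonnegative at `x₀` is a nonnegative combination of them. -/
structure IsSimpleSystem (W : Subgroup (OrthGroup n)) (α : Fin n → RSpace n)
    (x₀ : RSpace n) : Prop where
  isRoot : ∀ i, IsRoot W (α i)
  linearIndependent : LinearIndependent ℝ α
  inner_pos : ∀ i, 0 < inner ℝ (α i) x₀
  exists_nonneg : ∀ β, IsRoot W β → 0 ≤ inner ℝ β x₀ →
    ∃ c : Fin n → ℝ, (∀ i, 0 ≤ c i) ∧ β = ∑ i, c i • α i

namespace IsSimpleSystem

variable {W : Subgroup (OrthGroup n)} {α : Fin n → RSpace n} {x₀ : RSpace n}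

theorem inner_pos_of_isRoot (S : IsSimpleSystem W α x₀) {y : RSpace n}
    (hy : ∀ i, 0 < inner ℝ (α i) y) {β : RSpace n} (hβ : IsRoot W β)
    (h : 0 ≤ inner ℝ β x₀) : 0 < inner ℝ β y := by
  obtain ⟨c, hc, rfl⟩ := S.exists_nonneg β hβ h
  rw [sum_inner]
  simp only [real_inner_smul_left]
  refine (Finset.sum_nonneg fun i _ => mul_nonneg (hc i) (hy i).le).lt_of_ne fun h0 => ?_
  have h1 := (Finset.sum_eq_zero_iff_of_nonneg
    fun i _ => mul_nonneg (hc i) (hy i).le).1 h0.symm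
  refine hβ.ne_zero (Finset.sum_eq_zero fun i hi => ?_)
  rw [(mul_eq_zero.1 (h1 i hi)).resolve_right (hy i).ne', zero_smul]

theorem inner_ne_zero (S : IsSimpleSystem W α x₀) {β : RSpace n} (hβ : IsRoot W β) :
    inner ℝ β x₀ ≠ 0 := fun h =>
  (S.inner_pos_of_isRoot S.inner_pos hβ h.ge).ne' h

/-- Both `β` and `-R(α_i)β` are nonnegative combinations, and their sum is a multiple of `α_i`; so
every other coordinate of `β` vanishes. -/
theorem eq_of_reflection_neg (S : IsSimpleSystem W α x₀) {β : RSpace n} (hβ : IsRoot W β)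
    (h : 0 < inner ℝ β x₀) {i : Fin n} (hi : inner ℝ (R (α i) β) x₀ < 0) : β = α i := by
  obtain ⟨c, hc, hβc⟩ := S.exists_nonneg β hβ h.le
  obtain ⟨d, hd, hβd⟩ := S.exists_nonneg (-R (α i) β) (hβ.map (S.isRoot i).2).neg
    (by rw [inner_neg_left]; linarith)
  have hsum : ∑ j, (c j + d j - if j = i then 2 * inner ℝ (α i) β else 0) • α j = 0 := by
    simp only [sub_smul, add_smul, Finset.sum_sub_distrib, Finset.sum_add_distrib, ite_smul,
      zero_smul, Finset.sum_ite_eq', Finset.mem_univ, if_true]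
    rw [← hβc, ← hβd, R_apply _ (S.isRoot i).1]
    abel
  have hzero := Fintype.linearIndependent_iff.1 S.linearIndependent _ hsum
  have hβi : β = c i • α i := by
    rw [hβc]
    refine Finset.sum_eq_single i (fun j _ hj => ?_) (by simp)
    have := hzero j
    rw [if_neg hj] at this
    rw [show c j = 0 by linarith [hc j, hd j], zero_smul]
  have hci : c i = 1 := by
    have h1 := hβ.1
    rwa [hβi, norm_smul, (S.isRoot i).1, mul_one, Real.norm_of_nonneg (hc i)] at h1
  rw [hβi, hci, one_smul]

theorem exists_inner_pos (S : IsSimpleSystem W α x₀) {β : RSpace n} (hβ : IsRoot W β)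
    (h : 0 < inner ℝ β x₀) : ∃ i, 0 < inner ℝ (α i) β := by
  by_contra! hcon
  obtain ⟨c, hc, hβc⟩ := S.exists_nonneg β hβ h.le
  have h1 : inner ℝ β β = ∑ i, c i * inner ℝ (α i) β := by
    conv_lhs => rw [hβc, sum_inner]
    simp only [real_inner_smul_left]
    rw [← hβc]
  have h2 : ∑ i, c i * inner ℝ (α i) β ≤ 0 :=
    Finset.sum_nonpos fun i _ => mul_nonpos_of_nonneg_of_nonpos (hc i) (hcon i)
  rw [real_inner_self_eq_norm_sq, hβ.1] at h1
  linarith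

theorem closure_le (S : IsSimpleSystem W α x₀) :
    Subgroup.closure (Set.range fun i => R (α i)) ≤ W := by
  rw [Subgroup.closure_le]
  rintro _ ⟨i, rfl⟩
  exact (S.isRoot i).2

/-- Every reflection of `W` is a product of simple reflections. -/
theorem R_mem_closure (S : IsSimpleSystem W α x₀) [Finite W] {β : RSpace n}
    (hβ : IsRoot W β) : R β ∈ Subgroup.closure (Set.range fun i => R (α i)) := by
  wlog h : 0 < inner ℝ β x₀ generalizing β
  · rw [← R_neg]
    refine this hβ.neg ?_
    rw [inner_neg_left]
    have := lt_of_le_of_ne (not_lt.1 h) (S.inner_ne_zero hβ)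
    linarith
  set G := Subgroup.closure (Set.range fun i => R (α i)) with hG
  have hfin : (G : Set (OrthGroup n)).Finite := by
    have : (W : Set (OrthGroup n)).Finite := Set.toFinite _
    exact this.subset S.closure_le
  -- Take a positive root of least height in the orbit of `β` under `G`. A simple reflection that
  -- would lower it further must make it negative, so it is simple.
  obtain ⟨g, ⟨hgG, hgpos⟩, hmin⟩ := Set.exists_min_image
    {g : OrthGroup n | g ∈ G ∧ 0 < inner ℝ (g β) x₀} (fun g => inner ℝ (g β) x₀)
    (hfin.subset fun g hg => hg.1) ⟨1, G.one_mem, h⟩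
  have hroot : IsRoot W (g β) := hβ.map (S.closure_le hgG)
  obtain ⟨i, hi⟩ := S.exists_inner_pos hroot hgpos
  have hRi : R (α i) ∈ G := Subgroup.subset_closure ⟨i, rfl⟩
  have hneg : inner ℝ (R (α i) (g β)) x₀ < 0 := by
    refine lt_of_le_of_ne (not_lt.1 fun hpos => ?_)
      (S.inner_ne_zero (hroot.map (S.isRoot i).2))
    have h1 : inner ℝ (g β) x₀ ≤ inner ℝ (R (α i) (g β)) x₀ :=
      hmin (R (α i) * g) ⟨G.mul_mem hRi hgG, hpos⟩
    rw [R_apply _ (S.isRoot i).1, inner_sub_left, real_inner_smul_left] at h1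
    have := mul_pos hi (S.inner_pos i)
    linarith
  have heq := S.eq_of_reflection_neg hroot hgpos hneg
  have hR : R β = g⁻¹ * R (g β) * g := by
    rw [R_conj g hβ.1]
    group
  rw [hR, heq]
  exact G.mul_mem (G.mul_mem (G.inv_mem hgG) hRi) hgG

theorem exists_list_of_mem (S : IsSimpleSystem W α x₀) [Finite W]
    (hgen : Subgroup.closure (reflections W) = W) {w : OrthGroup n} (hw : w ∈ W) :
    ∃ L : List (Fin n), (L.map fun i => R (α i)).prod = w := by
  have hle : W ≤ Subgroup.closure (Set.range fun i => R (α i)) := by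
    conv_lhs => rw [← hgen]
    rw [Subgroup.closure_le]
    intro r hr
    obtain ⟨β, hβ, rfl⟩ := exists_isRoot_of_mem_reflections hr
    exact S.R_mem_closure hβ
  induction hle hw using Subgroup.closure_induction with
  | mem x hx =>
    obtain ⟨i, rfl⟩ := hx
    exact ⟨[i], by simp⟩
  | one => exact ⟨[], rfl⟩
  | mul x y hx hy ihx ihy =>
    obtain ⟨L, hL⟩ := ihx (S.closure_le hx)
    obtain ⟨M, hM⟩ := ihy (S.closure_le hy)
    exact ⟨L ++ M, by rw [List.map_append, List.prod_append, hL, hM]⟩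
  | inv x hx ih =>
    obtain ⟨L, hL⟩ := ih (S.closure_le hx)
    refine ⟨L.reverse, ?_⟩
    rw [← hL, List.prod_inv_reverse, List.map_reverse, List.map_map]
    simp only [Function.comp_def, R_inv]

theorem prod_mem (S : IsSimpleSystem W α x₀) (L : List (Fin n)) :
    (L.map fun i => R (α i)).prod ∈ W := by
  refine W.list_prod_mem fun r hr => ?_
  obtain ⟨i, -, rfl⟩ := List.mem_map.1 hr
  exact (S.isRoot i).2

/-- The strong exchange property. -/
theorem exchange (S : IsSimpleSystem W α x₀) {β : RSpace n} (hβ : IsRoot W β)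
    (h : 0 < inner ℝ β x₀) (L : List (Fin n))
    (hL : inner ℝ ((L.map fun i => R (α i)).prod β) x₀ < 0) :
    ∃ M : List (Fin n), M.length + 1 = L.length ∧
      (M.map fun i => R (α i)).prod = (L.map fun i => R (α i)).prod * R β := by
  induction L with
  | nil => exact absurd hL (not_lt.2 h.le)
  | cons i L ih =>
    rw [List.map_cons, List.prod_cons] at hL
    rcases lt_or_ge (inner ℝ ((L.map fun i => R (α i)).prod β) x₀) 0 with h1 | h1
    · obtain ⟨M, hM, hMp⟩ := ih h1
      refine ⟨i :: M, by simp [hM], ?_⟩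
      rw [List.map_cons, List.prod_cons, hMp, List.map_cons, List.prod_cons, mul_assoc]
    -- The sign flips exactly at the letter `i`, so the tail sends `β` to `α i`, and right
    -- multiplication by `R β` deletes that letter.
    · have hroot := hβ.map (S.prod_mem L)
      change inner ℝ (R (α i) ((L.map fun i => R (α i)).prod β)) x₀ < 0 at hL
      have heq := S.eq_of_reflection_neg hroot
        (lt_of_le_of_ne h1 (S.inner_ne_zero hroot).symm) hL
      refine ⟨L, rfl, ?_⟩
      rw [List.map_cons, List.prod_cons, ← heq, R_conj _ hβ.1, inv_mul_cancel_right,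
        mul_assoc, R_mul_self, mul_one]

/-- In a nonempty word fixing `x`, the prefix before the last letter `i` sends `α i` to a negative
root; exchange then shortens the word by two letters. -/
theorem prod_eq_one_of_fixes (S : IsSimpleSystem W α x₀) (L : List (Fin n)) {x : RSpace n}
    (hx : ∀ i, 0 < inner ℝ (α i) x) (hL : (L.map fun i => R (α i)).prod x = x) :
    (L.map fun i => R (α i)).prod = 1 := by
  induction hk : L.length using Nat.strong_induction_on generalizing L with
  | _ k ih =>
    rcases L.eq_nil_or_concat with rfl | ⟨M, i, rfl⟩
    · rfl
    · simp only [List.concat_eq_append, List.map_append, List.map_cons, List.map_nil,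
        List.prod_append, List.prod_cons, List.prod_nil, mul_one, List.length_append,
        List.length_cons, List.length_nil] at hL hk ⊢
      set g := (M.map fun i => R (α i)).prod with hg
      have hroot := (S.isRoot i).map (S.prod_mem M)
      rw [← hg] at hroot
      have h1 : inner ℝ (g (α i)) x < 0 := by
        have h2 : inner ℝ ((g * R (α i)) (α i)) ((g * R (α i)) x) = inner ℝ (α i) x :=
          (g * R (α i)).inner_map_map _ _
        rw [hL] at h2
        have h3 : (g * R (α i)) (α i) = -g (α i) := by
          change g (R (α i) (α i)) = _
          rw [R_self (S.isRoot i).1, map_neg]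
        rw [h3, inner_neg_left] at h2
        linarith [hx i]
      have h4 : inner ℝ (g (α i)) x₀ < 0 := by
        by_contra hcon
        exact absurd (S.inner_pos_of_isRoot hx hroot (not_lt.1 hcon)) (not_lt.2 h1.le)
      obtain ⟨N, hN, hNp⟩ := S.exchange (S.isRoot i) (S.inner_pos i) M h4
      rw [← hNp] at hL ⊢
      exact ih N.length (by omega) N hL rfl

/-- `W` acts freely on the regular points. -/
theorem eq_one_of_fixes (S : IsSimpleSystem W α x₀) [Finite W]
    (hgen : Subgroup.closure (reflections W) = W) {w : OrthGroup n} (hw : w ∈ W)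
    {x : RSpace n} (hx : x ∈ regularPoints W) (hwx : w x = x) : w = 1 := by
  -- The point of the orbit of `x` with the largest pairing with `x₀` lies in the chamber.
  obtain ⟨g, hgW, hmax⟩ := Set.exists_max_image (W : Set (OrthGroup n))
    (fun g => inner ℝ (g x) x₀) (Set.toFinite _) ⟨1, W.one_mem⟩
  have hpos : ∀ i, 0 < inner ℝ (α i) (g x) := by
    intro i
    refine lt_of_le_of_ne ?_ ?_
    · have h1 : inner ℝ (R (α i) (g x)) x₀ ≤ inner ℝ (g x) x₀ :=
        hmax (R (α i) * g) (W.mul_mem (S.isRoot i).2 hgW)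
      rw [R_apply _ (S.isRoot i).1, inner_sub_left, real_inner_smul_left] at h1
      by_contra! hneg
      have := mul_neg_of_neg_of_pos hneg (S.inner_pos i)
      linarith
    · have h2 := mem_regularPoints_iff.1 hx _ ((S.isRoot i).map (W.inv_mem hgW))
      rw [← g.inner_map_map] at h2
      have h3 : g (g⁻¹ (α i)) = α i := g.apply_symm_apply (α i)
      rw [h3] at h2
      exact h2.symm
  obtain ⟨L, hL⟩ := S.exists_list_of_mem hgen (W.mul_mem (W.mul_mem hgW hw) (W.inv_mem hgW))
  have h1 := S.prod_eq_one_of_fixes L hpos (by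
    rw [hL]
    change g (w (g⁻¹ (g x))) = g x
    have h3 : g⁻¹ (g x) = x := g.symm_apply_apply x
    rw [h3, hwx])
  rw [hL, mul_inv_eq_one] at h1
  exact mul_eq_left.1 h1

end IsSimpleSystem

/-! ### The chamber normals form a simple system -/

/-- The chamber is invariant under translation along `x`. A root not orthogonal to `x` would have
its hyperplane met by such a translate of `x₀`; hence `W` fixes `x`. -/
theorem eq_zero_of_forall_inner_eq_zero {W : Subgroup (OrthGroup n)}
    (hW : IsFiniteIrreducibleReflectionGroup W) {C : Set (RSpace n)} (hC : IsChamber W C)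
    {α : Fin n → RSpace n} (hα : IsInwardUnitNormals W C α) {x : RSpace n}
    (hx : ∀ i, inner ℝ (α i) x = 0) : x = 0 := by
  obtain ⟨x₀, hx₀, rfl⟩ := hC
  have hx₀C := mem_connectedComponentIn hx₀
  have hreg : ∀ y, (∀ i, 0 < inner ℝ (α i) y) → y ∈ regularPoints W := fun y hy =>
    connectedComponentIn_subset _ x₀ (hα.chamber_eq ▸ hy)
  rw [hα.chamber_eq] at hx₀C
  have hroot : ∀ β, IsRoot W β → inner ℝ β x = 0 := by
    intro β hβ
    by_contra hne
    refine mem_regularPoints_iff.1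
      (hreg (x₀ - (inner ℝ β x₀ / inner ℝ β x) • x) fun i => ?_) β hβ ?_
    · rw [inner_sub_right, inner_smul_right, hx, mul_zero, sub_zero]
      exact hx₀C i
    · rw [inner_sub_right, inner_smul_right, div_mul_cancel₀ _ hne, sub_self]
  refine hW.essential x fun w hw => ?_
  rw [← hW.generated] at hw
  induction hw using Subgroup.closure_induction with
  | mem r hr =>
    obtain ⟨β, hβ, rfl⟩ := exists_isRoot_of_mem_reflections hr
    rw [R_apply_eq_self_iff hβ.1, hroot β hβ]
  | one => rfl
  | mul g h _ _ ihg ihh =>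
    change g (h x) = x
    rw [ihh, ihg]
  | inv g _ ih =>
    conv_lhs => rw [← ih]
    exact g.symm_apply_apply x

theorem linearIndependent_normals {W : Subgroup (OrthGroup n)}
    (hW : IsFiniteIrreducibleReflectionGroup W) {C : Set (RSpace n)} (hC : IsChamber W C)
    {α : Fin n → RSpace n} (hα : IsInwardUnitNormals W C α) : LinearIndependent ℝ α := by
  refine linearIndependent_of_top_le_span_of_card_eq_finrank ?_ (by simp)
  rw [top_le_iff, ← Submodule.orthogonal_eq_bot_iff, Submodule.eq_bot_iff]
  intro x hx
  refine eq_zero_of_forall_inner_eq_zero hW hC hα fun i => ?_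
  exact (Submodule.mem_orthogonal _ _).1 hx _ (Submodule.subset_span ⟨i, rfl⟩)

theorem exists_isSimpleSystem {W : Subgroup (OrthGroup n)}
    (hW : IsFiniteIrreducibleReflectionGroup W) {C : Set (RSpace n)} (hC : IsChamber W C)
    {α : Fin n → RSpace n} (hα : IsInwardUnitNormals W C α) :
    ∃ x₀, IsSimpleSystem W α x₀ := by
  have hli := linearIndependent_normals hW hC hα
  obtain ⟨x₀, hx₀, rfl⟩ := hC
  have hx₀C := mem_connectedComponentIn hx₀
  have hreg : ∀ y, (∀ i, 0 < inner ℝ (α i) y) → y ∈ regularPoints W := fun y hy =>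
    connectedComponentIn_subset _ x₀ (hα.chamber_eq ▸ hy)
  rw [hα.chamber_eq] at hx₀C
  refine ⟨x₀, fun i => ⟨hα.unit i, hα.reflecting i⟩, hli, hx₀C, fun β hβ hpos => ?_⟩
  have : Nonempty (Fin n) := by
    by_contra hemp
    rw [not_nonempty_iff] at hemp
    exact hβ.ne_zero (by ext i; exact hemp.elim i)
  let b := basisOfLinearIndependentOfCardEqFinrank hli (by simp)
  have hb : ∀ i, b i = α i := fun i => by simp [b]
  refine ⟨fun i => b.repr β i, fun i => ?_, ?_⟩
  · by_contra! hneg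
    -- `ω` is the dual basis vector to `α i`. Moving `x₀` along it stays in the chamber, yet a
    -- negative coordinate of `β` would let it reach the hyperplane of `β`.
    let ω := (InnerProductSpace.toDual ℝ (RSpace n)).symm
      (LinearMap.toContinuousLinearMap (b.coord i))
    have hω : ∀ x, inner ℝ x ω = b.repr x i := fun x => by
      rw [real_inner_comm, InnerProductSpace.toDual_symm_apply]
      rfl
    refine mem_regularPoints_iff.1
      (hreg (x₀ + (inner ℝ β x₀ / -(b.repr β i)) • ω) fun j => ?_) β hβ ?_
    · rw [inner_add_right, inner_smul_right, hω, ← hb j, b.repr_self]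
      refine add_pos_of_pos_of_nonneg (by rw [hb]; exact hx₀C j) (mul_nonneg ?_ ?_)
      · exact div_nonneg hpos (by linarith)
      · rw [Finsupp.single_apply]
        split_ifs <;> norm_num
    · rw [inner_add_right, inner_smul_right, hω]
      have := hneg.ne
      field_simp
      ring
  · conv_lhs => rw [← b.sum_repr β]
    simp only [hb]

/-! ### Carter's formula -/

/-- A nontrivial element of `W` has a root in the orthogonal complement of its fixed space. -/
theorem exists_isRoot_mem_orthogonal {W : Subgroup (OrthGroup n)} [Finite W]
    {α : Fin n → RSpace n} {x₀ : RSpace n} (S : IsSimpleSystem W α x₀)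
    (hgen : Subgroup.closure (reflections W) = W) {w : OrthGroup n} (hw : w ∈ W)
    (hw1 : w ≠ 1) : ∃ β, IsRoot W β ∧ β ∈ (fixedSpace w)ᗮ := by
  by_contra! hcon
  let p : {r : W // (r : OrthGroup n) ∈ reflections W} → Submodule ℝ (fixedSpace w) :=
    fun r => (fixedSpace (r : OrthGroup n)).comap (fixedSpace w).subtype
  have hp : ∀ r, p r ≠ ⊤ := by
    rintro ⟨⟨r, hrW⟩, hr⟩ htop
    obtain ⟨β, hβ, rfl⟩ := exists_isRoot_of_mem_reflections hr
    refine hcon β hβ ((Submodule.mem_orthogonal' _ _).2 fun x hx => ?_)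
    have hmem : (⟨x, hx⟩ : fixedSpace w) ∈ p ⟨⟨R β, hrW⟩, hr⟩ := htop ▸ Submodule.mem_top
    exact (R_apply_eq_self_iff hβ.1 x).1 (mem_fixedSpace.1 hmem)
  -- Finitely many proper subspaces cannot cover a real vector space, so the fixed space of `w`
  -- contains a regular point.
  have hcover : ⋃ r, (p r : Set (fixedSpace w)) ≠ Set.univ := fun h => by
    obtain ⟨r, hr⟩ := Subspace.exists_eq_top_of_iUnion_eq_univ h
    exact hp r hr
  obtain ⟨x, hx⟩ := (Set.ne_univ_iff_exists_notMem _).1 hcover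
  refine hw1 (S.eq_one_of_fixes hgen hw (x := x) (fun r hr hrx => hx ?_)
    (mem_fixedSpace.1 x.2))
  exact Set.mem_iUnion.2 ⟨⟨⟨r, hr.1⟩, hr⟩, mem_fixedSpace.2 hrx⟩

theorem exists_reflections_prod_eq {W : Subgroup (OrthGroup n)} [Finite W]
    {α : Fin n → RSpace n} {x₀ : RSpace n} (S : IsSimpleSystem W α x₀)
    (hgen : Subgroup.closure (reflections W) = W) {w : OrthGroup n} (hw : w ∈ W) :
    ∃ L : List (OrthGroup n), (∀ r ∈ L, r ∈ reflections W) ∧ L.prod = w ∧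
      L.length + Module.finrank ℝ (fixedSpace w) ≤ n := by
  induction hd : n - Module.finrank ℝ (fixedSpace w) using Nat.strong_induction_on
    generalizing w with
  | _ d ih =>
    have hbound : ∀ v : OrthGroup n, Module.finrank ℝ (fixedSpace v) ≤ n := fun v => by
      simpa using (fixedSpace v).finrank_le
    by_cases hw1 : w = 1
    · exact ⟨[], by simp, hw1.symm, by simpa using hbound w⟩
    · obtain ⟨β, hβ, hmem⟩ := exists_isRoot_mem_orthogonal S hgen hw hw1
      have hlt := Submodule.finrank_lt_finrank_of_lt (fixedSpace_lt_of_mem_orthogonal hβ.1 hmem)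
      have hle := hbound (R β * w)
      obtain ⟨L, hL, hLp, hLl⟩ := ih _ (by omega) (W.mul_mem hβ.2 hw) rfl
      refine ⟨R β :: L, ?_, ?_, ?_⟩
      · rintro r (_ | ⟨_, hr⟩)
        exacts [hβ.mem_reflections, hL r hr]
      · rw [List.prod_cons, hLp, ← mul_assoc, R_mul_self, one_mul]
      · rw [List.length_cons]
        omega

/-- The part of the fixed space of `w` orthogonal to `v` has codimension at most one and stays
fixed. -/
theorem finrank_fixedSpace_le_add_one {v : RSpace n} (hv : ‖v‖ = 1) (w : OrthGroup n) :
    Module.finrank ℝ (fixedSpace w) ≤ Module.finrank ℝ (fixedSpace (R v * w)) + 1 := by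
  have hle : fixedSpace w ⊓ (ℝ ∙ v)ᗮ ≤ fixedSpace (R v * w) := by
    rintro x ⟨hx, hxv⟩
    rw [SetLike.mem_coe, mem_fixedSpace] at hx
    rw [mem_fixedSpace]
    change R v (w x) = x
    rw [hx, R_apply_eq_self_iff hv]
    exact Submodule.mem_orthogonal_singleton_iff_inner_right.1 hxv
  have h1 := Submodule.finrank_mono hle
  have h2 := Submodule.finrank_sup_add_finrank_inf_eq (fixedSpace w) (ℝ ∙ v)ᗮ
  have h3 := (ℝ ∙ v).finrank_add_finrank_orthogonal
  have h4 := (fixedSpace w ⊔ (ℝ ∙ v)ᗮ).finrank_le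
  have h5 := finrank_span_singleton (K := ℝ) (v := v) (by rintro rfl; simp at hv)
  omega

theorem le_length_add_finrank_fixedSpace {W : Subgroup (OrthGroup n)}
    (L : List (OrthGroup n)) (hL : ∀ r ∈ L, r ∈ reflections W) :
    n ≤ L.length + Module.finrank ℝ (fixedSpace L.prod) := by
  induction L with
  | nil =>
    have : fixedSpace (1 : OrthGroup n) = ⊤ :=
      (Submodule.eq_top_iff').2 fun x => mem_fixedSpace.2 rfl
    rw [List.prod_nil, this]
    simp
  | cons r L ih =>
    obtain ⟨β, hβ, rfl⟩ := exists_isRoot_of_mem_reflections (hL r (by simp))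
    have h1 := ih fun r hr => hL r (by simp [hr])
    have h2 := finrank_fixedSpace_le_add_one hβ.1 L.prod
    rw [List.prod_cons, List.length_cons]
    omega

/-- Carter's formula for the reflection length. -/
theorem reflLength_add_finrank_fixedSpace {W : Subgroup (OrthGroup n)} [Finite W]
    {α : Fin n → RSpace n} {x₀ : RSpace n} (S : IsSimpleSystem W α x₀)
    (hgen : Subgroup.closure (reflections W) = W) {w : OrthGroup n} (hw : w ∈ W) :
    reflLength W w + Module.finrank ℝ (fixedSpace w) = n := by
  obtain ⟨L, hL, hLp, hLl⟩ := exists_reflections_prod_eq S hgen hw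
  -- Nonemptiness is essential here, as `sInf ∅ = 0`.
  have hmem : L.length ∈ {k | ∃ L : List (OrthGroup n), L.length = k ∧
    (∀ r ∈ L, r ∈ reflections W) ∧ L.prod = w} := ⟨L, rfl, hL, hLp⟩
  have hle : reflLength W w ≤ L.length := Nat.sInf_le hmem
  obtain ⟨M, hM, hMr, hMp⟩ := Nat.sInf_mem ⟨_, hmem⟩
  have hge := le_length_add_finrank_fixedSpace M hMr
  rw [hMp, hM] at hge
  change n ≤ reflLength W w + _ at hge
  omega

/-! ### Invertibility of `γ - I` -/

theorem sub_prod_mem_span (L : List (RSpace n)) (hL : ∀ v ∈ L, ‖v‖ = 1) (x : RSpace n) :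
    x - (L.map R).prod x ∈ Submodule.span ℝ {v | v ∈ L} := by
  induction L with
  | nil => simp
  | cons a L ih =>
    have h1 := Submodule.span_mono (R := ℝ) (s := {v | v ∈ L}) (t := {v | v ∈ a :: L})
      (fun v hv => List.mem_cons_of_mem a hv) (ih fun v hv => hL v (by simp [hv]))
    have ha : a ∈ Submodule.span ℝ {v | v ∈ a :: L} := Submodule.subset_span (by simp)
    rw [List.map_cons, List.prod_cons]
    change x - R a ((L.map R).prod x) ∈ _
    rw [R_apply a (hL a (by simp)), ← sub_add]
    exact add_mem h1 (Submodule.smul_mem _ _ ha)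

/-- If `x` is fixed, the remaining factors act on `x` as `R(α 0)`, so `2(α 0·x)α 0` lies in the span
of the other vectors; independence forces `α 0·x = 0`. -/
theorem inner_eq_zero_of_prod_apply_eq_self {m : ℕ} (α : Fin m → RSpace n)
    (hli : LinearIndependent ℝ α) (hα : ∀ i, ‖α i‖ = 1) {x : RSpace n}
    (hx : (List.ofFn fun i => R (α i)).prod x = x) (i : Fin m) : inner ℝ (α i) x = 0 := by
  induction m with
  | zero => exact i.elim0
  | succ m ih =>
    obtain ⟨hli', hnot⟩ := linearIndependent_finSucc.1 hli
    rw [List.ofFn_succ, List.prod_cons] at hx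
    set P := (List.ofFn fun i : Fin m => R (α i.succ)).prod with hP
    have hPx : P x = R (α 0) x := by
      conv_rhs => rw [← hx]
      change P x = (R (α 0) * (R (α 0) * P)) x
      rw [← mul_assoc, R_mul_self, one_mul]
    have hspan : x - P x ∈ Submodule.span ℝ (Set.range (Fin.tail α)) := by
      have h1 := sub_prod_mem_span (List.ofFn fun i : Fin m => α i.succ)
        (fun v hv => by
          obtain ⟨j, rfl⟩ := (List.mem_ofFn' _ _).1 hv
          exact hα _) x
      rw [List.map_ofFn] at h1
      refine Submodule.span_mono ?_ h1
      intro v hv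
      obtain ⟨j, rfl⟩ := (List.mem_ofFn' _ _).1 hv
      exact ⟨j, rfl⟩
    have h0 : inner ℝ (α 0) x = 0 := by
      by_contra hne
      rw [hPx, R_apply _ (hα 0), sub_sub_cancel] at hspan
      exact hnot ((Submodule.smul_mem_iff _ (mul_ne_zero two_ne_zero hne)).1 hspan)
    rw [(R_apply_eq_self_iff (hα 0) x).2 h0] at hPx
    exact Fin.cases h0 (fun j => ih _ hli' (fun j => hα j.succ) hPx j) i

theorem isUnit_subId_coxeterElement {α : Fin n → RSpace n} (hli : LinearIndependent ℝ α)
    (hα : ∀ i, ‖α i‖ = 1) (hperp : ∀ x, (∀ i, inner ℝ (α i) x = 0) → x = 0) :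
    IsUnit (subId (coxeterElement α)) := by
  rw [LinearMap.isUnit_iff_ker_eq_bot, Submodule.eq_bot_iff]
  intro x hx
  exact hperp x (inner_eq_zero_of_prod_apply_eq_self α hli hα (mem_fixedSpace.1 hx))

/-! ### The vectors `μ` and the maximal fixed space -/

theorem apply_mu {γ : OrthGroup n} (hγ : IsUnit (subId γ)) (a : RSpace n) :
    γ (mu γ a) = mu γ a - (2 : ℝ) • a := by
  have h : subId γ (mu γ a) = (-2 : ℝ) • a := by
    rw [mu, map_smul]
    congr 1
    exact congrArg (fun f : Module.End ℝ (RSpace n) => f a) (Ring.mul_inverse_cancel _ hγ)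
  rw [subId_apply, sub_eq_iff_eq_add] at h
  rw [h, neg_smul]
  abel

/-- Expand `γμ(a)·γμ(b) = μ(a)·μ(b)` using `γμ(a) = μ(a) - 2a`. -/
theorem inner_mu_add_inner_mu {γ : OrthGroup n} (hγ : IsUnit (subId γ)) (a b : RSpace n) :
    inner ℝ (mu γ a) b + inner ℝ (mu γ b) a = 2 * inner ℝ a b := by
  have h := γ.inner_map_map (mu γ a) (mu γ b)
  rw [apply_mu hγ, apply_mu hγ, inner_sub_left, inner_sub_right, inner_sub_right,
    real_inner_smul_left, real_inner_smul_left, real_inner_smul_right, real_inner_smul_right,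
    real_inner_comm (mu γ b) a] at h
  linarith

theorem inner_mu_self {γ : OrthGroup n} (hγ : IsUnit (subId γ)) {a : RSpace n} (ha : ‖a‖ = 1) :
    inner ℝ (mu γ a) a = 1 := by
  have h := inner_mu_add_inner_mu hγ a a
  rw [real_inner_self_eq_norm_sq, ha] at h
  linarith

/-- For fixed `x`, `γx - x` is the displacement of `γx` under the reflections, so it lies in the
span of `L`; apply `-2(γ - I)⁻¹`. -/
theorem fixedSpace_le_span_mu {γ : OrthGroup n} (hγ : IsUnit (subId γ)) (L : List (RSpace n))
    (hL : ∀ v ∈ L, ‖v‖ = 1) :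
    fixedSpace ((L.map R).prod * γ) ≤ Submodule.span ℝ {v | v ∈ L.map (mu γ)} := by
  intro x hx
  rw [mem_fixedSpace] at hx
  change (L.map R).prod (γ x) = x at hx
  have h1 := sub_prod_mem_span L hL (γ x)
  rw [hx, ← subId_apply] at h1
  let m : Module.End ℝ (RSpace n) := (-2 : ℝ) • Ring.inverse (subId γ)
  have h2 : m (subId γ x) ∈ Submodule.span ℝ {v | v ∈ L.map (mu γ)} := by
    have h3 := Submodule.mem_map_of_mem (f := m) h1
    rw [Submodule.map_span] at h3
    refine Submodule.span_mono ?_ h3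
    rintro _ ⟨v, hv, rfl⟩
    exact List.mem_map.2 ⟨v, hv, rfl⟩
  have h4 : m (subId γ x) = (-2 : ℝ) • x :=
    congrArg (fun f : Module.End ℝ (RSpace n) => (-2 : ℝ) • f x) (Ring.inverse_mul_cancel _ hγ)
  rw [h4] at h2
  exact (Submodule.smul_mem_iff _ (by norm_num)).1 h2

theorem finrank_span_list_le (L : List (RSpace n)) :
    Module.finrank ℝ (Submodule.span ℝ {v | v ∈ L}) ≤ L.length := by
  classical
  have h := finrank_span_finset_le_card (R := ℝ) L.toFinset
  rw [Set.finrank, List.coe_toFinset] at h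
  exact h.trans L.toFinset_card_le

theorem finrank_fixedSpace_le_length {γ : OrthGroup n} (hγ : IsUnit (subId γ))
    (L : List (RSpace n)) (hL : ∀ v ∈ L, ‖v‖ = 1) :
    Module.finrank ℝ (fixedSpace ((L.map R).prod * γ)) ≤ L.length := by
  have h := (Submodule.finrank_mono (fixedSpace_le_span_mu hγ L hL)).trans
    (finrank_span_list_le (L.map (mu γ)))
  rwa [List.length_map] at h

/-- If the fixed space has the largest possible dimension, it is spanned by the `μ`'s. -/
theorem fixedSpace_eq_span_mu {γ : OrthGroup n} (hγ : IsUnit (subId γ))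
    (L : List (RSpace n)) (hL : ∀ v ∈ L, ‖v‖ = 1)
    (h : Module.finrank ℝ (fixedSpace ((L.map R).prod * γ)) = L.length) :
    fixedSpace ((L.map R).prod * γ) = Submodule.span ℝ {v | v ∈ L.map (mu γ)} := by
  refine Submodule.eq_of_le_of_finrank_le (fixedSpace_le_span_mu hγ L hL) ?_
  rw [h]
  simpa using finrank_span_list_le (L.map (mu γ))

theorem prod_apply_eq_self_of_inner_eq_zero (L : List (RSpace n)) (hL : ∀ v ∈ L, ‖v‖ = 1)
    {x : RSpace n} (hx : ∀ v ∈ L, inner ℝ v x = 0) : (L.map R).prod x = x := by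
  induction L with
  | nil => rfl
  | cons a L ih =>
    rw [List.map_cons, List.prod_cons]
    change R a ((L.map R).prod x) = x
    rw [ih (fun v hv => hL v (by simp [hv])) fun v hv => hx v (by simp [hv]),
      R_apply_eq_self_iff (hL a (by simp)), hx a (by simp)]

theorem finrank_fixedSpace_eq_length_iff {γ : OrthGroup n} (hγ : IsUnit (subId γ))
    (L : List (RSpace n)) (hL : ∀ v ∈ L, ‖v‖ = 1) :
    Module.finrank ℝ (fixedSpace ((L.map R).prod * γ)) = L.length ↔
      L.Pairwise fun a b => inner ℝ (mu γ b) a = 0 := by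
  induction L with
  | nil =>
    have : fixedSpace (([].map R).prod * γ) = ⊥ := by
      have h1 := (LinearMap.isUnit_iff_ker_eq_bot _).1 hγ
      rwa [List.map_nil, List.prod_nil, one_mul]
    rw [this]
    simp
  | cons a L ih =>
    have hL' : ∀ v ∈ L, ‖v‖ = 1 := fun v hv => hL v (by simp [hv])
    have ha : ‖a‖ = 1 := hL a (by simp)
    have hspan := fixedSpace_eq_span_mu hγ L hL'
    have hle' := finrank_fixedSpace_le_length hγ L hL'
    have hle := finrank_fixedSpace_le_length hγ (a :: L) hL
    replace ih := ih hL'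
    rw [List.pairwise_cons, ← ih]
    rw [List.map_cons, List.prod_cons, List.length_cons, mul_assoc] at hle ⊢
    set w := (L.map R).prod * γ with hw
    constructor
    · intro h
      have h1 := finrank_fixedSpace_le_add_one ha (R a * w)
      rw [← mul_assoc (R a) (R a) w, R_mul_self, one_mul] at h1
      have hdim : Module.finrank ℝ (fixedSpace w) = L.length := by omega
      refine ⟨fun b hb => ?_, hdim⟩
      have hinf : fixedSpace (R a * w) ⊓ (ℝ ∙ a)ᗮ ≤ fixedSpace w := by
        rintro x ⟨hx, hxa⟩
        rw [SetLike.mem_coe, mem_fixedSpace] at hx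
        have hax := (R_apply_eq_self_iff ha x).2
          (Submodule.mem_orthogonal_singleton_iff_inner_right.1 hxa)
        rw [mem_fixedSpace]
        have h2 : R a (R a (w x)) = w x :=
          congrArg (fun g : OrthGroup n => g (w x)) (R_mul_self a)
        change R a (w x) = x at hx
        rw [← h2, hx, hax]
      have hrank := Submodule.finrank_sup_add_finrank_inf_eq (fixedSpace (R a * w)) (ℝ ∙ a)ᗮ
      have h3 := (ℝ ∙ a).finrank_add_finrank_orthogonal
      have h4 := (fixedSpace (R a * w) ⊔ (ℝ ∙ a)ᗮ).finrank_le
      have h5 := finrank_span_singleton (K := ℝ) (v := a) (by rintro rfl; simp at ha)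
      -- The intersection with `a^⊥` has dimension at least `(L.length + 1) + (n - 1) - n`, which is
      -- that of the fixed space of `w`.
      have heq := Submodule.eq_of_le_of_finrank_le hinf (by omega)
      have hb' : mu γ b ∈ fixedSpace w := by
        rw [hspan hdim]
        exact Submodule.subset_span (List.mem_map.2 ⟨b, hb, rfl⟩)
      rw [← heq] at hb'
      rw [real_inner_comm]
      exact Submodule.mem_orthogonal_singleton_iff_inner_right.1 hb'.2
    · rintro ⟨hperp, hdim⟩
      have hortho : ∀ x ∈ fixedSpace w, inner ℝ a x = 0 := by
        intro x hx
        rw [hspan hdim] at hx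
        refine Submodule.mem_orthogonal_singleton_iff_inner_right.1
          ((Submodule.span_le (p := (ℝ ∙ a)ᗮ)).2 ?_ hx)
        intro v hv
        obtain ⟨b, hb, rfl⟩ := List.mem_map.1 hv
        refine Submodule.mem_orthogonal_singleton_iff_inner_right.2 ?_
        rw [real_inner_comm, hperp b hb]
      -- Polarization makes `γμ(a) = μ(a) - 2a` orthogonal to each `b` in `L`, so only `R a` moves
      -- it, and it returns it to `μ(a)` because `μ(a)·a = 1`. The same value keeps `μ(a)` out of
      -- the fixed space of `w`.
      have hmu : mu γ a ∈ fixedSpace (R a * w) := by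
        rw [mem_fixedSpace]
        change R a ((L.map R).prod (γ (mu γ a))) = _
        rw [prod_apply_eq_self_of_inner_eq_zero L hL' fun b hb => ?_]
        · rw [apply_mu hγ, map_sub, map_smul, R_self ha, R_apply a ha, real_inner_comm,
            inner_mu_self hγ ha, mul_one, smul_neg, sub_neg_eq_add, sub_add_cancel]
        · have h1 := inner_mu_add_inner_mu hγ a b
          rw [hperp b hb, real_inner_comm b a, real_inner_comm b] at h1
          rw [apply_mu hγ, inner_sub_right, real_inner_smul_right]
          linarith
      have hlt : fixedSpace w < fixedSpace (R a * w) := by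
        refine lt_of_le_of_ne (fun x hx => ?_) fun heq => ?_
        · have h1 := hortho x hx
          rw [mem_fixedSpace] at hx ⊢
          change R a (w x) = x
          rw [hx, R_apply_eq_self_iff ha, h1]
        · have h1 := hortho _ (heq ▸ hmu)
          rw [real_inner_comm, inner_mu_self hγ ha] at h1
          exact one_ne_zero h1
      have := Submodule.finrank_lt_finrank_of_lt hlt
      omega

/-! ### Assembling the equivalence -/

theorem isRoot_rho [NeZero n] {W : Subgroup (OrthGroup n)} {α : Fin n → RSpace n}
    (hα : ∀ i, IsRoot W (α i)) (m : ℕ) : IsRoot W (rho α m) := by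
  refine (hα _).map (W.list_prod_mem fun r hr => ?_)
  obtain ⟨j, -, rfl⟩ := List.mem_map.1 hr
  exact (hα _).2

end ReflGroup

theorem lemma3p4 {n : ℕ} [NeZero n] (W : Subgroup (OrthGroup n))
    (hW : ReflGroup.IsFiniteIrreducibleReflectionGroup W)
    (C : Set (RSpace n)) (hC : ReflGroup.IsChamber W C)
    (α : Fin n → RSpace n) (hα : ReflGroup.IsInwardUnitNormals W C α)
    (s : ℕ) (hs : s ≤ n) (hαs : ReflGroup.IsBipartiteOrdering α s)
    (k : ℕ) (σ : Fin k → RSpace n) (hσ : ReflGroup.IsConsistentlyOrdered α σ) :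
    IsUnit (ReflGroup.subId (ReflGroup.coxeterElement α)) ∧
    (((ReflGroup.reflLength W
          ((List.ofFn fun i => ReflGroup.R (σ i)).prod * ReflGroup.coxeterElement α) : ℕ) : ℤ)
        = (n : ℤ) - (k : ℤ) ↔
      ∀ i j : Fin k, j < i →
        inner ℝ (ReflGroup.mu (ReflGroup.coxeterElement α) (σ i)) (σ j) = 0) := by
  open ReflGroup in
  have : Finite W := hW.finite
  obtain ⟨x₀, S⟩ := exists_isSimpleSystem hW hC hα
  have hγ : IsUnit (subId (coxeterElement α)) :=
    isUnit_subId_coxeterElement S.linearIndependent hα.unit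
      fun x hx => eq_zero_of_forall_inner_eq_zero hW hC hα hx
  refine ⟨hγ, ?_⟩
  obtain ⟨m, -, hm⟩ := hσ
  have hroot : ∀ i, IsRoot W (σ i) := fun i => by
    rw [(hm i).2]
    exact isRoot_rho S.isRoot _
  have hmem : (List.ofFn fun i => R (σ i)).prod * coxeterElement α ∈ W := by
    refine W.mul_mem (W.list_prod_mem fun r hr => ?_) (W.list_prod_mem fun r hr => ?_) <;>
      obtain ⟨j, rfl⟩ := (List.mem_ofFn' _ _).1 hr
    exacts [(hroot j).2, (S.isRoot j).2]
  have hcarter := reflLength_add_finrank_fixedSpace S hW.generated hmem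
  have hiff := finrank_fixedSpace_eq_length_iff hγ (List.ofFn σ) fun v hv => by
    obtain ⟨j, rfl⟩ := (List.mem_ofFn' _ _).1 hv
    exact (hroot j).1
  rw [List.map_ofFn, List.length_ofFn, List.pairwise_ofFn] at hiff
  change Module.finrank ℝ (fixedSpace ((List.ofFn fun i => R (σ i)).prod * coxeterElement α)) = k
    ↔ _ at hiff
  refine Iff.trans ?_ (hiff.trans ⟨fun h i j hij => h hij, fun h i j hij => h j i hij⟩)
  omega
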